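/- Let $M$ be a connected topological surface (a Hausdorff, $\sigma$-compact topological $2$-manifold without boundary, orientable or not) and let $F$ be a homeomorphism of $M$ that is isotopic to the identity. Here an isotopy of a space $N$ is a continuous path $[0,1]\to\operatorname{Homeo}(N)$, where $\operatorname{Homeo}(N)$ carries the compact-open topology for homeomorphisms (the coarsest topology making $f\mapsto f$ and $f\mapsto f^{-1}$ continuous into $C(N,N)$ with the compact-open topology). Let $X\subset M$ be a closed set of fixed points of $F$, put $N_X=M\setminus X$, and let $I=(F_t)_{t\in[0,1]}$ be an isotopy of $N_X$ from $\operatorname{id}_{N_X}$ to $F|_{N_X}$ (one says that $(X,I)$ is a restricted isotopy). Let $y\in N_X$ be a fixed point of $F$ such that $F_t(y)\neq y$ for some $t$, and suppose that the loop $t\mapsto F_t(y)$ is null-homotopic in $N_X$ (with base point fixed). Then there is an isotopy $I'=(F'_t)_{t\in[0,1]}$ of $N_X$ from $\operatorname{id}_{N_X}$ to $F|_{N_X}$ such that $F'_t(y)=y$ for all $t\in[0,1]$, and $I'$ is homotopic to $I$ relative to the complement of a compact subset of $N_X$. That is, there are a compact set $K\subset N_X$ and a continuous map $\phi:[0,1]^2\to\operatorname{Homeo}(N_X)$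 with $\phi(0,t)=F_t$, $\phi(1,t)=F'_t$, $\phi(s,0)=\operatorname{id}_{N_X}$ and $\phi(s,1)=F|_{N_X}$ for all $s,t\in[0,1]$, such that for every $t$ the restriction of $\phi(s,t)$ to $N_X\setminus K$ does not depend on $s$. -/

import Mathlib

namespace SurfaceIsotopy

/-- The compact-open topology on the group of homeomorphisms of `N`: the coarsest topology for
which both `f ↦ f` and `f ↦ f⁻¹` are continuous into `C(N, N)` with the compact-open topology. -/
instance homeoTopology (N : Type*) [TopologicalSpace N] : TopologicalSpace (N ≃ₜ N) :=
  TopologicalSpace.induced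
    (fun f : N ≃ₜ N => ((f : C(N, N)), (f.symm : C(N, N)))) inferInstance

/-- An isotopy from the identity of `N` to `F`, i.e. a continuous path `t ↦ F_t` in the group of
homeomorphisms of `N` with `F_0 = id` and `F_1 = F`. -/
abbrev Isotopy {N : Type*} [TopologicalSpace N] (F : N ≃ₜ N) : Type _ :=
  Path (Homeomorph.refl N) F

/-- `F` is isotopic to the identity. -/
def IsotopicToId {N : Type*} [TopologicalSpace N] (F : N ≃ₜ N) : Prop :=
  Nonempty (Isotopy F)

theorem continuous_eval_point {N : Type*} [TopologicalSpace N] (z : N) :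
    Continuous (fun f : N ≃ₜ N => f z) := by
  have h : Continuous (fun f : N ≃ₜ N => ((f : C(N, N)), (f.symm : C(N, N)))) :=
    continuous_induced_dom
  exact (continuous_eval_const (F := C(N, N)) z).comp (continuous_fst.comp h)

/-- The trajectory `t ↦ F_t(z)` of the point `z` along an isotopy. -/
def trajectory {N : Type*} [TopologicalSpace N] {F : N ≃ₜ N} (I : Isotopy F) (z : N) :
    Path z (F z) where
  toFun t := I t z
  continuous_toFun := (continuous_eval_point z).comp I.continuous
  source' := by simp
  target' := by simp

/-- `Fix(I)`: the points that stay fixed along the whole isotopy. -/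
def fixedSet {N : Type*} [TopologicalSpace N] {F : N ≃ₜ N} (I : Isotopy F) : Set N :=
  {z | ∀ t, I t z = z}

/-- `Cont(I)`: the fixed points of `F` whose trajectory, which is then a loop, is null-homotopic
in `N` by a homotopy fixing the base point. Points of `Fix(I)` belong to it. -/
def contractibleSet {N : Type*} [TopologicalSpace N] {F : N ≃ₜ N} (I : Isotopy F) : Set N :=
  {z | ∃ hz : F z = z, ((trajectory I z).cast rfl hz.symm).Homotopic (Path.refl z)}

/-- Two isotopies from the identity to `F` are homotopic relative to `S` if there is a homotopy
with fixed endpoints `(s, t) ↦ H (s, t)` between them, in the group of homeomorphisms of `N`, such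
that the restriction of `H (s, t)` to `S` does not depend on `s`. -/
def HomotopicRelTo {N : Type*} [TopologicalSpace N] {F : N ≃ₜ N} (I I' : Isotopy F)
    (S : Set N) : Prop :=
  ∃ H : Path.Homotopy I I', ∀ z ∈ S, ∀ s s' t : unitInterval, H (s, t) z = H (s', t) z

theorem mem_compl_iff_apply {M : Type*} [TopologicalSpace M] (F : M ≃ₜ M) {X : Set M}
    (hXF : X ⊆ Function.fixedPoints F) (z : M) : z ∈ Xᶜ ↔ F z ∈ Xᶜ := by
  simp only [Set.mem_compl_iff, not_iff_not]
  constructor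
  · intro hz
    have h : F z = z := hXF hz
    rwa [h]
  · intro hz
    have h : F (F z) = F z := hXF hz
    rwa [← F.injective h]

/-- The restriction of `F` to the complement of a set of fixed points. -/
def restrictCompl {M : Type*} [TopologicalSpace M] (F : M ≃ₜ M) (X : Set M)
    (hXF : X ⊆ Function.fixedPoints F) : (Xᶜ : Set M) ≃ₜ (Xᶜ : Set M) :=
  F.subtype (mem_compl_iff_apply F hXF)

/-- The isotopies `I` such that `(X, I)` is a restricted isotopy of `F`: the isotopies on `M ∖ X`
from the identity to the restriction of `F`. The set `X` is to be a closed set of fixed points. -/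
abbrev RestrictedIsotopy {M : Type*} [TopologicalSpace M] (F : M ≃ₜ M) (X : Set M)
    (hXF : X ⊆ Function.fixedPoints F) : Type _ :=
  Isotopy (restrictCompl F X hXF)

end SurfaceIsotopy

/-! A null-homotopy `h` of the loop `t ↦ F_t(y)` is realised by ambient, compactly supported
homeomorphisms `Φ (s, t)`, trivial for `s = 0` and for `t ∈ {0, 1}`, with `Φ (1, t)` sending
`F_t(y)` to `y`. Then `φ (s, t) = Φ (s, t) ∘ F_t` is the desired homotopy of isotopies.

Such a `Φ` exists for any homotopy of maps from a compact Hausdorff space `P` to a manifold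
(`nonempty_deformation`). Deformations compose and invert, so by connectedness of the time line only
nearby times matter. For these, a partition of unity on `P` splits the motion into finitely many
steps, each changing the map only where it stays in one chart ball
(`eventually_nonempty_deformation`). A single step is made by `slide`, an explicit homeomorphism
supported in the ball and continuous in its parameters (`nonempty_deformation_of_chartBall`). -/

namespace SurfaceIsotopy

open Set Filter Topology unitInterval

/-! ### Moving points inside the unit ball of a normed space. -/

section Push

variable {E : Type*} [NormedAddCommGroup E]

theorem abs_bump_sub_le (x y : E) :
    |max 0 (1 - ‖x‖) - max 0 (1 - ‖y‖)| ≤ ‖x - y‖ := by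
  have h := abs_norm_sub_norm_le x y
  have h2 := abs_max_sub_max_le_abs (1 - ‖x‖) (1 - ‖y‖) 0
  rw [max_comm 0, max_comm 0]
  refine h2.trans ?_
  rw [sub_sub_sub_cancel_left, abs_sub_comm]
  exact h

variable [NormedSpace ℝ E]

/-- The map of `E` which moves `0` to `a` and is the identity outside of the open unit ball. -/
def push (a x : E) : E := x + max 0 (1 - ‖x‖) • a

/-- The inverse of `push a`, for `a` in the open unit ball. -/
noncomputable def pull (a : E) : E → E := Function.invFun (push a)

theorem push_zero (a : E) : push a 0 = a := by simp [push]

theorem push_of_one_le {x : E} (a : E) (hx : 1 ≤ ‖x‖) : push a x = x := by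
  simp [push, hx]

theorem continuous_push : Continuous fun p : E × E => push p.1 p.2 := by
  unfold push; fun_prop

/-- The bump is 1-Lipschitz with values in `[0, 1]`. Allowing two parameters makes one estimate
serve both injectivity of `push a` and joint continuity of `pull`. -/
theorem norm_sub_le_of_push {a : E} (a' x x' : E) :
    (1 - ‖a‖) * ‖x - x'‖ ≤ ‖push a x - push a' x'‖ + ‖a - a'‖ := by
  set u := max 0 (1 - ‖x‖)
  set v := max 0 (1 - ‖x'‖)
  have hv0 : 0 ≤ v := le_max_left _ _
  have hv1 : v ≤ 1 := max_le zero_le_one (by linarith [norm_nonneg x'])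
  have huv : |u - v| ≤ ‖x - x'‖ := abs_bump_sub_le x x'
  have e : x - x' = (push a x - push a' x') - (u - v) • a - v • (a - a') := by
    simp only [push, sub_smul, smul_sub, u, v]; abel
  have h1 : ‖x - x'‖ ≤ ‖push a x - push a' x'‖ + ‖(u - v) • a‖ + ‖v • (a - a')‖ := by
    calc ‖x - x'‖ = ‖(push a x - push a' x') - (u - v) • a - v • (a - a')‖ := by rw [← e]
      _ ≤ _ := (norm_sub_le _ _).trans (add_le_add_left (norm_sub_le _ _) _)
  rw [norm_smul, norm_smul, Real.norm_eq_abs, Real.norm_eq_abs, abs_of_nonneg hv0] at h1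
  have h2 := mul_le_mul_of_nonneg_right huv (norm_nonneg a)
  have h3 := mul_le_mul_of_nonneg_right hv1 (norm_nonneg (a - a'))
  linarith

theorem push_injective {a : E} (ha : ‖a‖ < 1) : Function.Injective (push a) := by
  intro x x' h
  have := norm_sub_le_of_push (a := a) a x x'
  rw [h, sub_self, sub_self, norm_zero, add_zero] at this
  have h0 : ‖x - x'‖ ≤ 0 := by
    by_contra! hc
    nlinarith
  exact sub_eq_zero.1 (norm_le_zero_iff.1 h0)

/-- `push a` differs from the identity by a `‖a‖`-Lipschitz map, so the Lipschitz form of the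
inverse function theorem applies. -/
theorem push_surjective [CompleteSpace E] {a : E} (ha : ‖a‖ < 1) :
    Function.Surjective (push a) := by
  have h : ApproximatesLinearOn (push a) ((ContinuousLinearEquiv.refl ℝ E : E ≃L[ℝ] E) : E →L[ℝ] E)
      univ ‖a‖₊ := by
    intro x _ y _
    have e : push a x - push a y - (x - y) = (max 0 (1 - ‖x‖) - max 0 (1 - ‖y‖)) • a := by
      simp only [push, sub_smul]; abel
    change ‖push a x - push a y - (x - y)‖ ≤ ‖a‖ * ‖x - y‖
    rw [e, norm_smul, mul_comm]
    exact mul_le_mul_of_nonneg_left (abs_bump_sub_le x y) (norm_nonneg a)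
  rcases subsingleton_or_nontrivial E with hE | hE
  · exact fun y => ⟨y, Subsingleton.elim _ _⟩
  · refine h.surjective (Or.inr ?_)
    have : ‖((ContinuousLinearEquiv.refl ℝ E).symm : E →L[ℝ] E)‖₊ = 1 := by
      ext
      simp
    rw [this, inv_one]
    exact_mod_cast ha

theorem pull_push {a : E} (ha : ‖a‖ < 1) (x : E) : pull a (push a x) = x :=
  Function.leftInverse_invFun (push_injective ha) x

theorem push_pull [CompleteSpace E] {a : E} (ha : ‖a‖ < 1) (x : E) : push a (pull a x) = x :=
  Function.rightInverse_invFun (push_surjective ha) x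

theorem pull_of_one_le {a x : E} (ha : ‖a‖ < 1) (hx : 1 ≤ ‖x‖) : pull a x = x := by
  conv_lhs => rw [← push_of_one_le a hx]
  exact pull_push ha x

theorem continuousOn_pull [CompleteSpace E] :
    ContinuousOn (fun p : E × E => pull p.1 p.2) {p | ‖p.1‖ < 1} := by
  rintro ⟨a, z⟩ ha
  simp only [mem_ofPred_eq] at ha
  have h1 : 0 < 1 - ‖a‖ := by linarith
  refine tendsto_iff_norm_sub_tendsto_zero.2 ?_
  have hlim : Tendsto (fun p : E × E => (‖z - p.2‖ + ‖a - p.1‖) / (1 - ‖a‖))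
      (𝓝[{p | ‖p.1‖ < 1}] (a, z)) (𝓝 0) := by
    have : Continuous fun p : E × E => (‖z - p.2‖ + ‖a - p.1‖) / (1 - ‖a‖) := by fun_prop
    simpa using (this.tendsto (a, z)).mono_left nhdsWithin_le_nhds
  refine squeeze_zero' (Eventually.of_forall fun _ => norm_nonneg _) ?_ hlim
  filter_upwards [self_mem_nhdsWithin] with p hp
  rw [le_div_iff₀ h1, mul_comm, norm_sub_rev]
  have := norm_sub_le_of_push (a := a) p.1 (pull a z) (pull p.1 p.2)
  rwa [push_pull ha, push_pull hp] at this

/-- For `a` and `b` in the open unit ball, a homeomorphism of `E` moving `a` to `b`. -/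
noncomputable def slide (a b x : E) : E := push b (pull a x)

theorem slide_apply_left {a : E} (ha : ‖a‖ < 1) (b : E) : slide a b a = b := by
  have : pull a a = 0 := by simpa [push_zero] using pull_push ha 0
  rw [slide, this, push_zero]

theorem slide_slide [CompleteSpace E] {a b : E} (ha : ‖a‖ < 1) (hb : ‖b‖ < 1) (x : E) :
    slide b a (slide a b x) = x := by
  rw [slide, slide, pull_push hb, push_pull ha]

theorem slide_self [CompleteSpace E] {a : E} (ha : ‖a‖ < 1) (x : E) : slide a a x = x :=
  push_pull ha x

theorem slide_of_one_le {a x : E} (ha : ‖a‖ < 1) (b : E) (hx : 1 ≤ ‖x‖) :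
    slide a b x = x := by
  rw [slide, pull_of_one_le ha hx, push_of_one_le b hx]

/-- The inverse `slide b a` fixes every point outside the ball, so none of them can be the image of
a point inside. -/
theorem norm_slide_lt_one [CompleteSpace E] {a b x : E} (ha : ‖a‖ < 1) (hb : ‖b‖ < 1)
    (hx : ‖x‖ < 1) : ‖slide a b x‖ < 1 := by
  by_contra! h
  have h1 := slide_slide ha hb x
  rw [slide_of_one_le hb a h] at h1
  rw [h1] at h
  exact absurd hx (not_lt.2 h)

theorem ContinuousOn.slide [CompleteSpace E] {Q : Type*} [TopologicalSpace Q] {a b x : Q → E}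
    {s : Set Q} (ha : ContinuousOn a s) (hb : ContinuousOn b s) (hx : ContinuousOn x s)
    (h : ∀ q ∈ s, ‖a q‖ < 1) : ContinuousOn (fun q => slide (a q) (b q) (x q)) s :=
  continuous_push.comp_continuousOn
    (hb.prodMk (continuousOn_pull.comp (ha.prodMk hx) fun q hq => h q hq))

end Push

/-! ### Transport to the manifold by a chart. -/

section Extend

variable {E : Type*} [NormedAddCommGroup E]
  {N : Type*} [TopologicalSpace N] (e : OpenPartialHomeomorph N E)

open Classical in
/-- The transport to `N` by a chart `e` of a self-map of `E`, extended by the identity. -/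
noncomputable def extend (g : E → E) (x : N) : N :=
  if x ∈ e.source then e.symm (g (e x)) else x

variable {e}

theorem extend_apply {x : N} (hx : x ∈ e.source) (g : E → E) : extend e g x = e.symm (g (e x)) :=
  if_pos hx

theorem extend_eq_self {g : E → E} {x : N} (h : x ∈ e.source → g (e x) = e x) :
    extend e g x = x := by
  unfold extend
  split_ifs with hx
  · rw [h hx, e.left_inv hx]
  · rfl

/-- The part of the domain of a chart that is mapped to the open unit ball. -/
def chartBall (e : OpenPartialHomeomorph N E) : Set N := e.source ∩ e ⁻¹' Metric.ball 0 1

/-- The part of the domain of a chart that is mapped to the closed unit ball. -/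
def chartClosedBall (e : OpenPartialHomeomorph N E) : Set N := e.symm '' Metric.closedBall 0 1

theorem isOpen_chartBall : IsOpen (chartBall e) :=
  e.isOpen_inter_preimage Metric.isOpen_ball

theorem norm_lt_one_of_mem_chartBall {x : N} (hx : x ∈ chartBall e) : ‖e x‖ < 1 := by
  simpa using hx.2

theorem isCompact_chartClosedBall [ProperSpace E] (he : Metric.closedBall 0 1 ⊆ e.target) :
    IsCompact (chartClosedBall e) :=
  (isCompact_closedBall _ _).image_of_continuousOn (e.continuousOn_symm.mono he)

theorem one_le_norm_of_notMem {x : N} (hx : x ∈ e.source) (h : x ∉ chartClosedBall e) :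
    1 ≤ ‖e x‖ := by
  by_contra! hc
  exact h ⟨e x, by simpa using hc.le, e.left_inv hx⟩

variable [NormedSpace ℝ E]

theorem extend_slide_of_notMem {a b : E} {x : N} (ha : ‖a‖ < 1) (h : x ∉ chartClosedBall e) :
    extend e (slide a b) x = x :=
  extend_eq_self fun hx => slide_of_one_le ha b (one_le_norm_of_notMem hx h)

theorem slide_mem_target [CompleteSpace E] {a b x : E} (he : Metric.closedBall 0 1 ⊆ e.target)
    (ha : ‖a‖ < 1) (hb : ‖b‖ < 1) (hx : x ∈ e.target) : slide a b x ∈ e.target := by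
  rcases lt_or_ge ‖x‖ 1 with h | h
  · exact he (by simpa using (norm_slide_lt_one ha hb h).le)
  · rwa [slide_of_one_le ha b h]

theorem extend_slide_extend_slide [CompleteSpace E] {a b : E}
    (he : Metric.closedBall 0 1 ⊆ e.target) (ha : ‖a‖ < 1) (hb : ‖b‖ < 1) (x : N) :
    extend e (slide b a) (extend e (slide a b) x) = x := by
  by_cases hx : x ∈ e.source
  · have ht := slide_mem_target he ha hb (e.map_source hx)
    rw [extend_apply hx, extend_apply (e.map_target ht), e.right_inv ht, slide_slide ha hb,
      e.left_inv hx]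
  · have : ∀ g : E → E, extend e g x = x := fun g => extend_eq_self fun h => absurd h hx
    rw [this, this]

/-- The chart domain and the complement of the closed chart ball form an open cover, since that ball
is compact in a Hausdorff space. The map is the chart formula on the first and the identity on the
second. -/
theorem continuousOn_extend_slide [ProperSpace E] [CompleteSpace E] [T2Space N]
    (he : Metric.closedBall 0 1 ⊆ e.target) {Q : Type*} [TopologicalSpace Q] {a b : Q → E}
    {s : Set Q} (hs : IsOpen s) (ha : ContinuousOn a s) (hb : ContinuousOn b s)
    (ha1 : ∀ q ∈ s, ‖a q‖ < 1) (hb1 : ∀ q ∈ s, ‖b q‖ < 1) :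
    ContinuousOn (fun p : Q × N => extend e (slide (a p.1) (b p.1)) p.2) (s ×ˢ univ) := by
  rintro ⟨q, x⟩ ⟨hq, -⟩
  simp only at hq
  apply ContinuousAt.continuousWithinAt
  by_cases hx : x ∈ chartClosedBall e
  · have hx' : x ∈ e.source := by
      obtain ⟨z, hz, rfl⟩ := hx
      exact e.map_target (he hz)
    have hc : ContinuousOn (fun p : Q × N => e.symm (slide (a p.1) (b p.1) (e p.2)))
        (s ×ˢ e.source) := by
      refine e.continuousOn_symm.comp (ContinuousOn.slide ?_ ?_ ?_ ?_) ?_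
      · exact ha.comp continuousOn_fst fun p hp => hp.1
      · exact hb.comp continuousOn_fst fun p hp => hp.1
      · exact e.continuousOn.comp continuousOn_snd fun p hp => hp.2
      · exact fun p hp => ha1 _ hp.1
      · exact fun p hp => slide_mem_target he (ha1 _ hp.1) (hb1 _ hp.1) (e.map_source hp.2)
    have ho : s ×ˢ e.source ∈ 𝓝 (q, x) := (hs.prod e.open_source).mem_nhds ⟨hq, hx'⟩
    refine (hc.continuousAt ho).congr ?_
    filter_upwards [ho] with p hp
    exact (extend_apply hp.2 _).symm
  · have ho : s ×ˢ (chartClosedBall e)ᶜ ∈ 𝓝 (q, x) :=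
      (hs.prod (isCompact_chartClosedBall he).isClosed.isOpen_compl).mem_nhds ⟨hq, hx⟩
    refine (continuousAt_snd (p := (q, x))).congr ?_
    filter_upwards [ho] with p hp
    exact (extend_slide_of_notMem (ha1 _ hp.1) hp.2).symm

theorem exists_chart_closedBall_subset [ChartedSpace E N] (x : N) :
    ∃ e : OpenPartialHomeomorph N E, x ∈ chartBall e ∧ Metric.closedBall 0 1 ⊆ e.target := by
  set c := chartAt E x
  obtain ⟨r, hr, hsub⟩ := Metric.nhds_basis_closedBall.mem_iff.1
    (c.open_target.mem_nhds (c.map_source (mem_chart_source E x)))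
  let T : E ≃ₜ E := (Homeomorph.subRight (c x)).trans (Homeomorph.smulOfNeZero r⁻¹ (by positivity))
  have hT : T (c x) = 0 := by simp [T]
  refine ⟨c.transHomeomorph T, ⟨mem_chart_source E x, ?_⟩, ?_⟩
  · simp [hT]
  · intro z hz
    change T.symm z ∈ c.target
    apply hsub
    have : T.symm z = r • z + c x := by
      rw [Homeomorph.symm_apply_eq]
      simp [T, hr.ne']
    rw [this]
    simp only [Metric.mem_closedBall, dist_zero_right] at hz ⊢
    rw [dist_eq_norm, add_sub_cancel_right, norm_smul, Real.norm_eq_abs, abs_of_pos hr]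
    nlinarith

end Extend

/-- A compactly supported ambient deformation of `N`, parametrized by `P`, carrying `f p` to `g p`:
families `Φ (s, p)` and `Ψ (s, p)` of mutually inverse homeomorphisms which start at the identity
for `s = 0`, are the identity for `p ∈ A`, and such that `Φ (1, p)` maps `f p` to `g p`. -/
structure Deformation {P N : Type*} [TopologicalSpace P] [TopologicalSpace N] (A : Set P)
    (f g : P → N) where
  Φ : I × P → N → N
  Ψ : I × P → N → N
  continuous_Φ : Continuous fun q : (I × P) × N => Φ q.1 q.2
  continuous_Ψ : Continuous fun q : (I × P) × N => Ψ q.1 q.2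
  Ψ_Φ : ∀ q x, Ψ q (Φ q x) = x
  Φ_Ψ : ∀ q x, Φ q (Ψ q x) = x
  Φ_zero : ∀ p x, Φ (0, p) x = x
  Φ_of_mem : ∀ s, ∀ p ∈ A, ∀ x, Φ (s, p) x = x
  Φ_one : ∀ p, Φ (1, p) (f p) = g p
  supp : Set N
  isCompact_supp : IsCompact supp
  Φ_of_notMem : ∀ q, ∀ x ∉ supp, Φ q x = x

/-! ### Identity, inverse and composition of deformations. -/

namespace Deformation

variable {P N : Type*} [TopologicalSpace P] [TopologicalSpace N] {A : Set P} {f g h : P → N}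

/-- The constant deformation. -/
def refl (A : Set P) (f : P → N) : Deformation A f f where
  Φ _ x := x
  Ψ _ x := x
  continuous_Φ := continuous_snd
  continuous_Ψ := continuous_snd
  Ψ_Φ _ _ := rfl
  Φ_Ψ _ _ := rfl
  Φ_zero _ _ := rfl
  Φ_of_mem _ _ _ _ := rfl
  Φ_one _ := rfl
  supp := ∅
  isCompact_supp := isCompact_empty
  Φ_of_notMem _ _ _ := rfl

theorem Ψ_eq_self (D : Deformation A f g) {q : I × P} {x : N} (hx : D.Φ q x = x) :
    D.Ψ q x = x := by
  conv_lhs => rw [← hx]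
  exact D.Ψ_Φ q x

/-- The inverse deformation. -/
def symm (D : Deformation A f g) : Deformation A g f where
  Φ := D.Ψ
  Ψ := D.Φ
  continuous_Φ := D.continuous_Ψ
  continuous_Ψ := D.continuous_Φ
  Ψ_Φ := D.Φ_Ψ
  Φ_Ψ := D.Ψ_Φ
  Φ_zero p x := D.Ψ_eq_self (D.Φ_zero p x)
  Φ_of_mem s p hp x := D.Ψ_eq_self (D.Φ_of_mem s p hp x)
  Φ_one p := by rw [← D.Φ_one, D.Ψ_Φ]
  supp := D.supp
  isCompact_supp := D.isCompact_supp
  Φ_of_notMem q x hx := D.Ψ_eq_self (D.Φ_of_notMem q x hx)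

/-- The composition of two deformations. -/
def trans (D : Deformation A f g) (D' : Deformation A g h) : Deformation A f h where
  Φ q x := D'.Φ q (D.Φ q x)
  Ψ q x := D.Ψ q (D'.Ψ q x)
  continuous_Φ := D'.continuous_Φ.comp (continuous_fst.prodMk D.continuous_Φ)
  continuous_Ψ := D.continuous_Ψ.comp (continuous_fst.prodMk D'.continuous_Ψ)
  Ψ_Φ q x := by rw [D'.Ψ_Φ, D.Ψ_Φ]
  Φ_Ψ q x := by rw [D.Φ_Ψ, D'.Φ_Ψ]
  Φ_zero p x := by rw [D.Φ_zero, D'.Φ_zero]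
  Φ_of_mem s p hp x := by rw [D.Φ_of_mem s p hp, D'.Φ_of_mem s p hp]
  Φ_one p := by rw [D.Φ_one, D'.Φ_one]
  supp := D.supp ∪ D'.supp
  isCompact_supp := D.isCompact_supp.union D'.isCompact_supp
  Φ_of_notMem q x hx := by
    rw [D.Φ_of_notMem q x fun h => hx (Or.inl h), D'.Φ_of_notMem q x fun h => hx (Or.inr h)]

end Deformation

/-! ### Deformations supported in one chart. -/

section Local

variable {E : Type*} [NormedAddCommGroup E] [NormedSpace ℝ E] [ProperSpace E]
  {N : Type*} [TopologicalSpace N] [T2Space N] {e : OpenPartialHomeomorph N E}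
  {P : Type*} [TopologicalSpace P]

open Classical in
-- On `O ∖ C` the slide is from a point to itself, hence trivial, so the two branches agree on the
-- overlap of the open sets `O` and `Cᶜ`.
theorem continuous_ite_extend_slide (he : Metric.closedBall 0 1 ⊆ e.target) {Q : Type*}
    [TopologicalSpace Q] {a b : Q → E} {C O : Set Q} (hC : IsClosed C) (hO : IsOpen O)
    (hCO : C ⊆ O) (ha : ContinuousOn a O) (hb : ContinuousOn b O)
    (ha1 : ∀ q ∈ O, ‖a q‖ < 1) (hb1 : ∀ q ∈ O, ‖b q‖ < 1) (hab : ∀ q ∈ O, q ∉ C → a q = b q) :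
    Continuous fun p : Q × N =>
      if p.1 ∈ C then extend e (slide (a p.1) (b p.1)) p.2 else p.2 := by
  rw [continuous_iff_continuousAt]
  rintro ⟨q, x⟩
  by_cases hq : q ∈ C
  · have ho : O ×ˢ univ ∈ 𝓝 (q, x) := (hO.prod isOpen_univ).mem_nhds ⟨hCO hq, trivial⟩
    refine ((continuousOn_extend_slide he hO ha hb ha1 hb1).continuousAt ho).congr ?_
    filter_upwards [ho] with p hp
    split_ifs with hpC
    · rfl
    · rw [hab _ hp.1 hpC]
      exact extend_eq_self fun _ => slide_self (hb1 _ hp.1) _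
  · refine (continuousAt_snd (p := (q, x))).congr ?_
    filter_upwards [(hC.isOpen_compl.prod isOpen_univ).mem_nhds ⟨hq, mem_univ x⟩] with p hp
    rw [if_neg hp.1]

open Classical in
/-- Two maps that agree outside of a closed set, which both map into a ball of a chart, are
related by a deformation. -/
theorem nonempty_deformation_of_chartBall (he : Metric.closedBall 0 1 ⊆ e.target)
    {A C : Set P} {f g : P → N} (hf : Continuous f) (hg : Continuous g) (hC : IsClosed C)
    (hfC : MapsTo f C (chartBall e)) (hgC : MapsTo g C (chartBall e))
    (hfg : ∀ p ∉ C, f p = g p) (hA : ∀ p ∈ A, f p = g p) : Nonempty (Deformation A f g) := by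
  let O : Set (I × P) := {q | f q.2 ∈ chartBall e ∧ g q.2 ∈ chartBall e}
  have hO : IsOpen O :=
    (isOpen_chartBall.preimage (hf.comp continuous_snd)).inter
      (isOpen_chartBall.preimage (hg.comp continuous_snd))
  let D : Set (I × P) := {q | q.2 ∈ C}
  have hD : IsClosed D := hC.preimage continuous_snd
  have hDO : D ⊆ O := fun q hq => ⟨hfC hq, hgC hq⟩
  let a : I × P → E := fun q => e (f q.2)
  -- The target moves along the segment from `f` to `g` in the chart, which stays in the ball by
  -- convexity.
  let b : I × P → E := fun q => (1 - (q.1 : ℝ)) • e (f q.2) + (q.1 : ℝ) • e (g q.2)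
  have ha : ContinuousOn a O :=
    e.continuousOn.comp (hf.comp continuous_snd).continuousOn fun q hq => hq.1.1
  have hc : ContinuousOn (fun q : I × P => e (g q.2)) O :=
    e.continuousOn.comp (hg.comp continuous_snd).continuousOn fun q hq => hq.2.1
  have hs : ContinuousOn (fun q : I × P => (q.1 : ℝ)) O := by fun_prop
  have hb : ContinuousOn b O := ((continuousOn_const.sub hs).smul ha).add (hs.smul hc)
  have ha1 : ∀ q ∈ O, ‖a q‖ < 1 := fun q hq => norm_lt_one_of_mem_chartBall hq.1
  have hb1 : ∀ q ∈ O, ‖b q‖ < 1 := by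
    intro q hq
    have := convex_ball (0 : E) 1 hq.1.2 hq.2.2 (sub_nonneg.2 q.1.2.2) q.1.2.1 (sub_add_cancel _ _)
    simpa using this
  have hself : ∀ q, f q.2 = g q.2 → a q = b q := by
    intro q hq
    simp only [a, b, hq]
    rw [← add_smul, sub_add_cancel, one_smul]
  have hab : ∀ q ∈ O, q ∉ D → a q = b q := fun q _ hq => hself q (hfg _ hq)
  refine ⟨{
    Φ := fun q x => if q ∈ D then extend e (slide (a q) (b q)) x else x
    Ψ := fun q x => if q ∈ D then extend e (slide (b q) (a q)) x else x
    continuous_Φ := continuous_ite_extend_slide he hD hO hDO ha hb ha1 hb1 hab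
    continuous_Ψ := continuous_ite_extend_slide he hD hO hDO hb ha hb1 ha1
      fun q hq h => (hab q hq h).symm
    Ψ_Φ := ?_
    Φ_Ψ := ?_
    Φ_zero := ?_
    Φ_of_mem := ?_
    Φ_one := ?_
    supp := chartClosedBall e
    isCompact_supp := isCompact_chartClosedBall he
    Φ_of_notMem := ?_ }⟩
  · intro q x
    split_ifs with hq
    · exact extend_slide_extend_slide he (ha1 q (hDO hq)) (hb1 q (hDO hq)) x
    · rfl
  · intro q x
    split_ifs with hq
    · exact extend_slide_extend_slide he (hb1 q (hDO hq)) (ha1 q (hDO hq)) x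
    · rfl
  · intro p x
    split_ifs with hq
    · have : b (0, p) = a (0, p) := by simp [a, b]
      rw [this]
      exact extend_eq_self fun _ => slide_self (ha1 _ (hDO hq)) _
    · rfl
  · intro s p hp x
    split_ifs with hq
    · rw [← hself (s, p) (hA p hp)]
      exact extend_eq_self fun _ => slide_self (ha1 _ (hDO hq)) _
    · rfl
  · intro p
    split_ifs with hq
    · have h1 : b (1, p) = e (g p) := by simp [b]
      rw [extend_apply (hDO hq).1.1, slide_apply_left (ha1 _ (hDO hq)), h1,
        e.left_inv (hDO hq).2.1]
    · exact hfg p hq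
  · intro q x hx
    split_ifs with hq
    · exact extend_slide_of_notMem (ha1 _ (hDO hq)) hx
    · rfl

end Local

/-! ### From homotopies to ambient deformations. -/

section Homotopy

variable {N : Type*} [TopologicalSpace N] [T2Space N]
  {P : Type*} [TopologicalSpace P] [CompactSpace P] [T2Space P]

open Classical in
theorem eventually_nonempty_deformation (E : Type*) [NormedAddCommGroup E] [NormedSpace ℝ E]
    [ProperSpace E] [ChartedSpace E N] {A : Set P} {h : ℝ → P → N}
    (hh : Continuous fun q : ℝ × P => h q.1 q.2) (hA : ∀ s s', ∀ p ∈ A, h s p = h s' p) (s₀ : ℝ) :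
    ∀ᶠ s in 𝓝 s₀, Nonempty (Deformation A (h s₀) (h s)) := by
  have key : ∀ p : P, ∃ (e : OpenPartialHomeomorph N E) (δ : ℝ) (J : Set P), 0 < δ ∧ IsOpen J ∧
      p ∈ J ∧ Metric.closedBall 0 1 ⊆ e.target ∧
      ∀ s ∈ Metric.ball s₀ δ, ∀ p' ∈ J, h s p' ∈ chartBall e := by
    intro p
    obtain ⟨e, hpe, he⟩ := exists_chart_closedBall_subset (E := E) (h s₀ p)
    have hn : {q : ℝ × P | h q.1 q.2 ∈ chartBall e} ∈ 𝓝 (s₀, p) :=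
      (isOpen_chartBall.preimage hh).mem_nhds hpe
    obtain ⟨u, hu, v, hv, huv⟩ := mem_nhds_prod_iff.1 hn
    obtain ⟨δ, hδ, hδu⟩ := Metric.mem_nhds_iff.1 hu
    obtain ⟨J, hJv, hJ, hpJ⟩ := mem_nhds_iff.1 hv
    exact ⟨e, δ, J, hδ, hJ, hpJ, he, fun s hs p' hp' => huv (mk_mem_prod (hδu hs) (hJv hp'))⟩
  choose e δ J hδ hJ hpJ he hmem using key
  obtain ⟨t, ht⟩ := isCompact_univ.elim_finite_subcover J hJ
    fun p _ => mem_iUnion.2 ⟨p, hpJ p⟩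
  have hev : ∀ᶠ s in 𝓝 s₀, ∀ i ∈ t, s ∈ Metric.ball s₀ (δ i) :=
    (t.eventually_all).2 fun i _ => Metric.ball_mem_nhds s₀ (hδ i)
  filter_upwards [hev] with s hs
  obtain ⟨ρ, hρ⟩ := PartitionOfUnity.exists_isSubordinate isClosed_univ (fun i : t => J i)
    (fun i => hJ i) (by simpa [iUnion_subtype] using ht)
  -- Partial sums of the partition serve as clocks running from 0 to 1: in `F T` below, adding an
  -- index `i` to `T` changes the map only on the support of `ρ i`, inside `J i`.
  let u : Finset t → P → ℝ := fun T p => ∑ i ∈ T, ρ i p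
  have hu0 : ∀ T p, 0 ≤ u T p := fun T p => Finset.sum_nonneg fun i _ => ρ.nonneg i p
  have huniv : ∀ p, u Finset.univ p = 1 := fun p => by
    have := ρ.sum_eq_one (mem_univ p)
    rwa [finsum_eq_sum_of_fintype] at this
  have hu1 : ∀ T p, u T p ≤ 1 := fun T p => by
    rw [← huniv p]
    exact Finset.sum_le_sum_of_subset_of_nonneg (Finset.subset_univ T) fun i _ _ => ρ.nonneg i p
  have huc : ∀ T, Continuous (u T) := fun T =>
    continuous_finsetSum T fun i _ => (ρ i).continuous
  let F : Finset t → P → N := fun T p => h (s₀ + u T p * (s - s₀)) p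
  have hFc : ∀ T, Continuous (F T) := fun T =>
    hh.comp ((continuous_const.add ((huc T).mul continuous_const)).prodMk continuous_id)
  have hball : ∀ T p, ∀ i ∈ t, s₀ + u T p * (s - s₀) ∈ Metric.ball s₀ (δ i) := by
    intro T p i hi
    have h1 := hs i hi
    rw [Metric.mem_ball, Real.dist_eq] at h1 ⊢
    rw [add_sub_cancel_left, abs_mul, abs_of_nonneg (hu0 T p)]
    nlinarith [hu1 T p, hu0 T p, abs_nonneg (s - s₀)]
  have hind : ∀ T, Nonempty (Deformation A (F ∅) (F T)) := by
    intro T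
    induction T using Finset.induction_on with
    | empty => exact ⟨Deformation.refl A _⟩
    | insert i T hi ih =>
      obtain ⟨D⟩ := ih
      obtain ⟨D'⟩ := nonempty_deformation_of_chartBall (he i) (A := A) (C := tsupport (ρ i))
        (hFc T) (hFc (insert i T)) (isClosed_tsupport _)
        (fun p hp => hmem i _ (hball T p i i.2) p (hρ i hp))
        (fun p hp => hmem i _ (hball _ p i i.2) p (hρ i hp))
        (fun p hp => by
          have : ρ i p = 0 := image_eq_zero_of_notMem_tsupport hp
          simp only [F, u, Finset.sum_insert hi, this, zero_add])
        (fun p hp => hA _ _ p hp)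
      exact ⟨D.trans D'⟩
  have h0 : F ∅ = h s₀ := by
    ext p
    simp [F, u]
  have h1 : F Finset.univ = h s := by
    ext p
    simp only [F, huniv, one_mul, add_sub_cancel]
  have := hind Finset.univ
  rwa [h0, h1] at this

/-- The homotopy extension property for points: homotopic maps to a manifold are related by a
compactly supported ambient deformation. -/
theorem nonempty_deformation (E : Type*) [NormedAddCommGroup E] [NormedSpace ℝ E]
    [ProperSpace E] [ChartedSpace E N] {A : Set P} {h : ℝ → P → N}
    (hh : Continuous fun q : ℝ × P => h q.1 q.2) (hA : ∀ s s', ∀ p ∈ A, h s p = h s' p)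
    (s s' : ℝ) : Nonempty (Deformation A (h s) (h s')) := by
  refine PreconnectedSpace.induction₂' (fun s s' => Nonempty (Deformation A (h s) (h s')))
    (fun x => ?_) ⟨fun _ _ _ ⟨D⟩ ⟨D'⟩ => ⟨D.trans D'⟩⟩ s s'
  filter_upwards [eventually_nonempty_deformation E hh hA x] with s ⟨D⟩
  exact ⟨⟨D⟩, ⟨D.symm⟩⟩

end Homotopy

/-! ### Application to isotopies. -/

section Isotopy

variable {N : Type*} [TopologicalSpace N]

theorem continuous_homeomorph_iff [LocallyCompactSpace N] {Q : Type*} [TopologicalSpace Q]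
    {Φ : Q → N ≃ₜ N} :
    Continuous Φ ↔ (Continuous fun p : Q × N => Φ p.1 p.2) ∧
      Continuous fun p : Q × N => (Φ p.1).symm p.2 := by
  rw [continuous_induced_rng, continuous_prodMk]
  refine and_congr ⟨fun h => ?_, fun h => ?_⟩ ⟨fun h => ?_, fun h => ?_⟩
  · exact ContinuousMap.continuous_uncurry_of_continuous ⟨_, h⟩
  · exact ContinuousMap.continuous_of_continuous_uncurry _ h
  · exact ContinuousMap.continuous_uncurry_of_continuous ⟨_, h⟩
  · exact ContinuousMap.continuous_of_continuous_uncurry _ h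

/-- The homeomorphisms in a deformation. -/
def Deformation.toHomeomorph {P : Type*} [TopologicalSpace P] {A : Set P} {f g : P → N}
    (D : Deformation A f g) (q : I × P) : N ≃ₜ N where
  toFun := D.Φ q
  invFun := D.Ψ q
  left_inv := D.Ψ_Φ q
  right_inv := D.Φ_Ψ q
  continuous_toFun := D.continuous_Φ.comp (Continuous.prodMk_right q)
  continuous_invFun := D.continuous_Ψ.comp (Continuous.prodMk_right q)

theorem exists_homotopicRelTo_of_mem_contractibleSet (E : Type*) [NormedAddCommGroup E]
    [NormedSpace ℝ E] [ProperSpace E] [T2Space N] [ChartedSpace E N] {F : N ≃ₜ N}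
    (J : Isotopy F) {y : N} (hy : y ∈ contractibleSet J) :
    ∃ J' : Isotopy F, y ∈ fixedSet J' ∧ ∃ K : Set N, IsCompact K ∧ HomotopicRelTo J J' Kᶜ := by
  have : LocallyCompactSpace N := ChartedSpace.locallyCompactSpace E N
  obtain ⟨hFy, ⟨h⟩⟩ := hy
  -- The null-homotopy fixes the base point, so taking `A = {0, 1}` keeps the endpoints of the
  -- isotopy; `projIcc` extends it to real times.
  obtain ⟨D⟩ := nonempty_deformation E (A := ({0, 1} : Set I)) (N := N)
    (h := fun s t => h (projIcc 0 1 zero_le_one s, t))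
    (h.continuous.comp (((continuous_projIcc).comp continuous_fst).prodMk continuous_snd))
    (by
      rintro s s' p (rfl | rfl)
      · rw [h.source, h.source]
      · rw [h.target, h.target]) 0 1
  obtain ⟨hJ, hJs⟩ := continuous_homeomorph_iff.1 J.continuous
  let φ : I × I → N ≃ₜ N := fun q => (J q.2).trans (D.toHomeomorph q)
  have hφ : Continuous φ := by
    refine continuous_homeomorph_iff.2 ⟨?_, ?_⟩
    · exact D.continuous_Φ.comp (continuous_fst.prodMk
        (hJ.comp ((continuous_snd.comp continuous_fst).prodMk continuous_snd)))
    · exact hJs.comp ((continuous_snd.comp continuous_fst).prodMk D.continuous_Ψ)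
  have hφ_of_mem : ∀ s, ∀ t ∈ ({0, 1} : Set I), φ (s, t) = J t := by
    intro s t ht
    ext x
    exact D.Φ_of_mem s t ht _
  have hφ0 : ∀ s, φ (s, 0) = Homeomorph.refl N := fun s => by
    rw [hφ_of_mem s 0 (by simp), J.source]
  have hφ1 : ∀ s, φ (s, 1) = F := fun s => by
    rw [hφ_of_mem s 1 (by simp), J.target]
  let J' : Isotopy F :=
    { toFun := fun t => φ (1, t)
      continuous_toFun := hφ.comp (Continuous.prodMk_right 1)
      source' := hφ0 1
      target' := hφ1 1 }
  -- The compact set is the union over `t` of the preimages of `D.supp` under `J t`, because `D`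
  -- acts after `J t`.
  refine ⟨J', fun t => ?_, (fun p : I × N => (J p.1).symm p.2) '' (univ ×ˢ D.supp),
    (isCompact_univ.prod D.isCompact_supp).image hJs, ?_, ?_⟩
  · have h1 := D.Φ_one t
    simp only [projIcc_left, projIcc_right] at h1
    have e0 : h ((⟨0, by simp⟩ : I), t) = J t y := h.apply_zero t
    have e1 : h ((⟨1, by simp⟩ : I), t) = y := h.apply_one t
    rw [e0, e1] at h1
    exact h1
  · exact
      { toFun := φ
        continuous_toFun := hφ
        map_zero_left := fun t => by
          ext x
          exact D.Φ_zero t _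
        map_one_left := fun t => rfl
        prop' := by
          rintro s t (rfl | rfl)
          · exact (hφ0 s).trans J.source.symm
          · exact (hφ1 s).trans J.target.symm }
  · intro z hz s s' t
    have hzt : J t z ∉ D.supp := fun hmem =>
      hz ⟨(t, J t z), ⟨trivial, hmem⟩, (J t).symm_apply_apply z⟩
    exact (D.Φ_of_notMem (s, t) _ hzt).trans (D.Φ_of_notMem (s', t) _ hzt).symm

end Isotopy

end SurfaceIsotopy

theorem mainTheorem6 {M : Type*} [TopologicalSpace M] [T2Space M] [SigmaCompactSpace M]
    [ConnectedSpace M] [ChartedSpace (EuclideanSpace ℝ (Fin 2)) M]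
    (F : M ≃ₜ M) (hF : SurfaceIsotopy.IsotopicToId F)
    (X : Set M) (hX : IsClosed X) (hXF : X ⊆ Function.fixedPoints F)
    (I : SurfaceIsotopy.RestrictedIsotopy F X hXF)
    (y : (Xᶜ : Set M))
    (hy : y ∈ SurfaceIsotopy.contractibleSet I \ SurfaceIsotopy.fixedSet I) :
    ∃ I' : SurfaceIsotopy.RestrictedIsotopy F X hXF,
      y ∈ SurfaceIsotopy.fixedSet I' ∧
      ∃ K : Set (Xᶜ : Set M), IsCompact K ∧ SurfaceIsotopy.HomotopicRelTo I I' Kᶜ := by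
  let _ : ChartedSpace (EuclideanSpace ℝ (Fin 2)) (Xᶜ : Set M) :=
    inferInstanceAs (ChartedSpace _ (⟨Xᶜ, hX.isOpen_compl⟩ : TopologicalSpace.Opens M))
  exact SurfaceIsotopy.exists_homotopicRelTo_of_mem_contractibleSet (EuclideanSpace ℝ (Fin 2)) I
    hy.1
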